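/- Let $n,d\ge 1$ be integers. A complete flag in $\mathbb{C}^n$ is a chain $E_\bullet=\{\{0\}=E_0\subset E_1\subset\cdots\subset E_n=\mathbb{C}^n\}$ of linear subspaces with $\dim E_i=i$. For $d$ complete flags $E^1_\bullet,\dots,E^d_\bullet$ and $0\le a_1,\dots,a_d\le n$ write $E_{a_1,\dots,a_d}=E^1_{a_1}\cap\cdots\cap E^d_{a_d}$. Let $T_{n,d}=\{x\in\mathbb{Z}_{\ge 0}^d : x_1+\cdots+x_d=n-1\}$ (and $T_{0,d}=\emptyset$), and let $\mathcal{T}_{n,d}$ be the matroid on the ground set $T_{n,d}$ whose independent sets are the subsets $I\subseteq T_{n,d}$ such that, for every $k\le n$, every parallel translate $a+T_{k,d}$ with $a\in\mathbb{Z}_{\ge 0}^d$ contains at most $k$ points of $I$. The matroid of a finite set of lines through the origin of $\mathbb{C}^n$ has these lines as its ground set and the linearly independent sets of lines as its independent sets. **Theorem.** If $d$ complete flags $E^1_\bullet,\dots,E^d_\bullet$ in $\mathbb{C}^n$ are generic enough, then the matroid of the $\binom{n+d-2}{d-1}$ lines determined by them is isomorphic to $\mathcal{T}_{n,d}$. Precisely,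 there is a nonempty Zariski open subset $U$ of the $d$-fold product of the variety $GL_n(\mathbb{C})/B$ of complete flags in $\mathbb{C}^n$ such that, for all $(E^1_\bullet,\dots,E^d_\bullet)\in U$: 1. $E_{a_1,\dots,a_d}$ is one-dimensional if and only if $a_1+\cdots+a_d=(d-1)n+1$; 2. there are exactly $\binom{n+d-2}{d-1}$ distinct lines of the form $E_{a_1,\dots,a_d}$; 3. the map $(x_1,\dots,x_d)\mapsto E_{n-x_1,\dots,n-x_d}$ is a bijection from $T_{n,d}$ onto this set of lines, and it is an isomorphism from $\mathcal{T}_{n,d}$ to the matroid of these lines. -/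

import Mathlib

/-! ### Complete flags in `ℂ^n` and the lines they determine -/

/-- A complete flag `{0} = E_0 ⊂ E_1 ⊂ ⋯ ⊂ E_n = ℂ^n`, with `dim E_i = i`. -/
structure CompleteFlag (n : ℕ) where
  /-- The `i`-dimensional member of the flag. -/
  space : Fin (n + 1) → Submodule ℂ (Fin n → ℂ)
  mono : Monotone space
  finrank_space : ∀ i, Module.finrank ℂ (space i) = (i : ℕ)

/-- The flag of an invertible matrix `g`: its `i`-th member is spanned by the first `i` columns
of `g`. This is the quotient map from `GL_n(ℂ)` onto the flag variety `GL_n(ℂ) / B`, where `B` is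
the group of invertible upper triangular matrices. -/
def CompleteFlag.ofGL {n : ℕ} (g : Matrix.GeneralLinearGroup (Fin n) ℂ) : CompleteFlag n where
  space i := Submodule.span ℂ ((fun j => (g : Matrix (Fin n) (Fin n) ℂ).col j) ''
    {j : Fin n | (j : ℕ) < (i : ℕ)})
  mono := fun _ _ h => Submodule.span_mono (Set.image_mono fun j (hj : (j : ℕ) < _) =>
    show (j : ℕ) < _ from lt_of_lt_of_le hj h)
  finrank_space := by
    intro i
    have hli : LinearIndependent ℂ (g : Matrix (Fin n) (Fin n) ℂ).col :=
      Matrix.linearIndependent_cols_iff_isUnit.2 g.isUnit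
    have h := finrank_span_eq_card (hli.comp (fun j : {j : Fin n // (j : ℕ) < (i : ℕ)} => j.1)
      Subtype.val_injective)
    have hc : Fintype.card {j : Fin n // (j : ℕ) < (i : ℕ)} = (i : ℕ) := by
      rw [Fintype.card_subtype, Fin.card_filter_val_lt]
      exact min_eq_right (Nat.lt_succ_iff.1 i.2)
    rw [hc] at h
    rw [Set.range_comp, Subtype.range_val_subtype] at h
    exact h

/-- Zariski open subsets of the `d`-fold product of the variety of complete flags in `ℂ^n`.
The variety of complete flags is `GL_n(ℂ) / B` with the quotient topology, so a set of `d`-tuples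
of flags is Zariski open if and only if its preimage in `GL_n(ℂ)^d` is, that is, if and only if
this preimage is the locus where at least one polynomial of some set of polynomials in the
matrix entries does not vanish. -/
def IsZariskiOpen {n d : ℕ} (U : Set (Fin d → CompleteFlag n)) : Prop :=
  ∃ S : Set (MvPolynomial (Fin d × Fin n × Fin n) ℂ),
    ∀ g : Fin d → Matrix.GeneralLinearGroup (Fin n) ℂ,
      (fun k => CompleteFlag.ofGL (g k)) ∈ U ↔
        ∃ P ∈ S, MvPolynomial.eval
          (fun p => (g p.1 : Matrix (Fin n) (Fin n) ℂ) p.2.1 p.2.2) P ≠ 0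

/-- The intersection `E^1_{a_1} ∩ ⋯ ∩ E^d_{a_d}`. -/
def flagIntersection {n d : ℕ} (E : Fin d → CompleteFlag n) (a : Fin d → Fin (n + 1)) :
    Submodule ℂ (Fin n → ℂ) :=
  ⨅ k, (E k).space (a k)

/-- The line arrangement determined by `d` flags: all one-dimensional subspaces of the form
`E^1_{a_1} ∩ ⋯ ∩ E^d_{a_d}`. -/
def lineArrangement {n d : ℕ} (E : Fin d → CompleteFlag n) : Set (Submodule ℂ (Fin n → ℂ)) :=
  {L | Module.finrank ℂ L = 1 ∧ ∃ a, flagIntersection E a = L}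

/-- The intersection `E^1_{n - x_1} ∩ ⋯ ∩ E^d_{n - x_d}`, indexed by the vector
`(x_1, …, x_d)` of codimensions. -/
def codimIntersection {n d : ℕ} (E : Fin d → CompleteFlag n) (x : Fin d → ℕ) :
    Submodule ℂ (Fin n → ℂ) :=
  flagIntersection E fun k => ⟨n - x k, Nat.lt_succ_of_le (Nat.sub_le n (x k))⟩

/-! ### The matroid of a set of lines -/

section LineMatroid

variable {V : Type*} [AddCommGroup V] [Module ℂ V]

theorem exists_generator_of_finrank_eq_one (L : Submodule ℂ V) :
    ∃ v : V, Module.finrank ℂ L = 1 → v ≠ 0 ∧ Submodule.span ℂ {v} = L := by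
  by_cases h : Module.finrank ℂ L = 1
  · obtain ⟨v, hv, h0⟩ := finrank_eq_one_iff'.1 h
    refine ⟨v, fun _ => ⟨fun h' => hv (Subtype.ext h'), le_antisymm ?_ ?_⟩⟩
    · simp
    · intro w hw
      obtain ⟨c, hc⟩ := h0 ⟨w, hw⟩
      exact Submodule.mem_span_singleton.2 ⟨c, congrArg Subtype.val hc⟩
  · exact ⟨0, fun h' => absurd h' h⟩

theorem sSupIndep_lines_iff {𝓛 : Set (Submodule ℂ V)} {v : Submodule ℂ V → V}
    (hv : ∀ L ∈ 𝓛, v L ≠ 0 ∧ Submodule.span ℂ {v L} = L) {I : Set (Submodule ℂ V)}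
    (hI : I ⊆ 𝓛) : sSupIndep I ↔ LinearIndepOn ℂ v I := by
  rw [sSupIndep_iff, LinearIndepOn,
    ← iSupIndep_iff_linearIndependent_of_ne_zero (fun i : I => (hv i (hI i.2)).1)]
  have : ((↑) : I → Submodule ℂ V) = fun i : I => Submodule.span ℂ {v i} :=
    funext fun i => ((hv i (hI i.2)).2).symm
  rw [← this]

variable [FiniteDimensional ℂ V]

theorem LinearIndepOn.exists_insert_of_encard_lt {ι : Type*} {v : ι → V} {I J : Set ι}
    (hI : LinearIndepOn ℂ v I) (hJ : LinearIndepOn ℂ v J) (hIJ : I.encard < J.encard) :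
    ∃ e ∈ J, e ∉ I ∧ LinearIndepOn ℂ v (insert e I) := by
  by_contra! hcon
  have hsub : v '' J ⊆ Submodule.span ℂ (v '' I) := by
    rintro _ ⟨e, he, rfl⟩
    by_cases heI : e ∈ I
    · exact Submodule.subset_span ⟨e, heI, rfl⟩
    · by_contra hn
      exact hcon e he heI ((linearIndepOn_insert heI).2 ⟨hI, hn⟩)
  have h1 := (LinearIndepOn.encard_le_toENat_rank hI)
  have h2 := (LinearIndepOn.encard_le_toENat_rank hJ)
  have hIf : I.Finite := Set.encard_ne_top_iff.1 (ne_top_of_lt hIJ)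
  have hJf : J.Finite := by
    refine Set.encard_ne_top_iff.1 (ne_top_of_le_ne_top ?_ h2)
    simp [← Module.finrank_eq_rank]
  have := hIf.fintype
  have := hJf.fintype
  have e1 := finrank_span_eq_card hI
  have e2 := finrank_span_eq_card hJ
  rw [← Set.image_eq_range] at e1 e2
  have hle := Submodule.finrank_mono (Submodule.span_le.2 hsub)
  rw [e1, e2] at hle
  rw [← Set.coe_fintypeCard, ← Set.coe_fintypeCard, Nat.cast_lt] at hIJ
  omega

/-- The matroid of a set `𝓛` of lines through the origin of a finite-dimensional complex vector
space: its ground set is `𝓛`, and a set of lines is independent if and only if the lines are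
linearly independent (equivalently, nonzero vectors chosen one on each line are linearly
independent). -/
def lineMatroid (𝓛 : Set (Submodule ℂ V)) (h𝓛 : ∀ L ∈ 𝓛, Module.finrank ℂ L = 1) :
    Matroid (Submodule ℂ V) :=
  (IndepMatroid.ofBddAugment 𝓛 (fun I => I ⊆ 𝓛 ∧ sSupIndep I)
    ⟨Set.empty_subset _, sSupIndep_empty⟩
    (fun _ _ hJ hIJ => ⟨hIJ.trans hJ.1, hJ.2.mono hIJ⟩)
    (by
      intro I J hI hJ hIJ
      choose v hv using exists_generator_of_finrank_eq_one (V := V)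
      have hv' : ∀ L ∈ 𝓛, v L ≠ 0 ∧ Submodule.span ℂ {v L} = L := fun L hL => hv L (h𝓛 L hL)
      obtain ⟨e, heJ, heI, he⟩ := LinearIndepOn.exists_insert_of_encard_lt
        ((sSupIndep_lines_iff hv' hI.1).1 hI.2) ((sSupIndep_lines_iff hv' hJ.1).1 hJ.2) hIJ
      have hs : insert e I ⊆ 𝓛 := Set.insert_subset (hJ.1 heJ) hI.1
      exact ⟨e, heJ, heI, hs, (sSupIndep_lines_iff hv' hs).2 he⟩)
    (by
      choose v hv using exists_generator_of_finrank_eq_one (V := V)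
      have hv' : ∀ L ∈ 𝓛, v L ≠ 0 ∧ Submodule.span ℂ {v L} = L := fun L hL => hv L (h𝓛 L hL)
      refine ⟨Module.finrank ℂ V, fun I hI => ?_⟩
      have h := ((sSupIndep_lines_iff hv' hI.1).1 hI.2).encard_le_toENat_rank
      simpa [← Module.finrank_eq_rank] using h)
    (fun _ hI => hI.1)).matroid

end LineMatroid

/-- The matroid of the line arrangement determined by `d` flags. -/
def flagLineMatroid {n d : ℕ} (E : Fin d → CompleteFlag n) : Matroid (Submodule ℂ (Fin n → ℂ)) :=
  lineMatroid (lineArrangement E) fun _ hL => hL.1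

/-! ### The matroid `𝒯_{n,d}` on the lattice points of a simplex -/

/-- `T_{n,d}`: the lattice points `x ≥ 0` of `ℝ^d` with `x_1 + ⋯ + x_d = n - 1`
(the empty set for `n = 0`). -/
def latticeSimplex (n d : ℕ) : Set (Fin d → ℕ) :=
  {x | ∑ i, x i + 1 = n}

/-- The family of subsets `I` of `T_{n,d}` such that, for every `k ≤ n`, every parallel translate
of `T_{k,d}` contains at most `k` points of `I`. -/
def SimplexIndep (n d : ℕ) (I : Set (Fin d → ℕ)) : Prop :=
  I ⊆ latticeSimplex n d ∧
    ∀ k ≤ n, ∀ a : Fin d → ℕ, (I ∩ ((fun x => a + x) '' latticeSimplex k d)).ncard ≤ k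

theorem latticeSimplex_finite (n d : ℕ) : (latticeSimplex n d).Finite := by
  refine (Set.finite_Icc (0 : Fin d → ℕ) (fun _ => n)).subset fun x hx => ⟨fun i => Nat.zero_le _,
    fun i => ?_⟩
  have h1 := Finset.single_le_sum (f := x) (fun j _ => Nat.zero_le _) (Finset.mem_univ i)
  have h2 : ∑ i, x i + 1 = n := hx
  show x i ≤ n
  omega

/-- The defining condition, with the simplices of size `n - ∑ a_i` written as
`{x ∈ T_{n,d} | x ≥ a}`. -/
theorem simplexIndep_iff {n d : ℕ} {I : Set (Fin d → ℕ)} :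
    SimplexIndep n d I ↔ I ⊆ latticeSimplex n d ∧
      ∀ a : Fin d → ℕ, (I ∩ {x | a ≤ x}).ncard ≤ n - ∑ i, a i := by
  refine and_congr_right fun hI => ⟨fun h a => ?_, fun h k hk a => ?_⟩
  · refine le_trans (Set.ncard_le_ncard ?_ (((latticeSimplex_finite n d).subset hI).inter_of_left _))
      (h (n - ∑ i, a i) (Nat.sub_le _ _) a)
    rintro x ⟨hx, hax⟩
    refine ⟨hx, x - a, ?_, ?_⟩
    · have h1 : ∑ i, x i + 1 = n := hI hx
      have h2 : ∑ i, a i + ∑ i, (x - a) i = ∑ i, x i := by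
        rw [← Finset.sum_add_distrib]
        exact Finset.sum_congr rfl fun i _ => Nat.add_sub_cancel' (hax i)
      show ∑ i, (x - a) i + 1 = n - ∑ i, a i
      omega
    · exact add_tsub_cancel_of_le hax
  · rcases Set.eq_empty_or_nonempty (I ∩ ((fun x => a + x) '' latticeSimplex k d)) with h0 | h0
    · simp [h0]
    · obtain ⟨_, hx, y, hy, rfl⟩ := h0
      have h1 : ∑ i, (a + y) i + 1 = n := hI hx
      have h2 : ∑ i, y i + 1 = k := hy
      simp only [Pi.add_apply, Finset.sum_add_distrib] at h1
      have hka : n - ∑ i, a i = k := by omega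
      rw [← hka]
      refine le_trans (Set.ncard_le_ncard ?_
        (((latticeSimplex_finite n d).subset hI).inter_of_left _)) (h a)
      rintro _ ⟨hz, w, -, rfl⟩
      exact ⟨hz, fun i => Nat.le_add_right _ _⟩

/-- The join of two saturated simplices with a common point is saturated. -/
theorem saturated_inf {n d : ℕ} {I : Set (Fin d → ℕ)} (hI : SimplexIndep n d I)
    {a b z : Fin d → ℕ} (hz : z ∈ latticeSimplex n d) (haz : a ≤ z) (hbz : b ≤ z)
    (ha : (I ∩ {x | a ≤ x}).ncard = n - ∑ i, a i) (hb : (I ∩ {x | b ≤ x}).ncard = n - ∑ i, b i) :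
    (I ∩ {x | a ⊓ b ≤ x}).ncard = n - ∑ i, (a ⊓ b) i := by
  rw [simplexIndep_iff] at hI
  have hfin : I.Finite := (latticeSimplex_finite n d).subset hI.1
  have h1 := hI.2 (a ⊓ b)
  have h2 := hI.2 (a ⊔ b)
  have hu : ((I ∩ {x | a ≤ x}) ∪ (I ∩ {x | b ≤ x})).ncard ≤ (I ∩ {x | a ⊓ b ≤ x}).ncard := by
    refine Set.ncard_le_ncard ?_ (hfin.inter_of_left _)
    rintro x (⟨hx, h⟩ | ⟨hx, h⟩)
    · exact ⟨hx, le_trans (b := a) inf_le_left h⟩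
    · exact ⟨hx, le_trans (b := b) inf_le_right h⟩
  have hi : (I ∩ {x | a ≤ x}) ∩ (I ∩ {x | b ≤ x}) = I ∩ {x | a ⊔ b ≤ x} := by
    ext x
    simp only [Set.mem_inter_iff, Set.mem_ofPred_eq, sup_le_iff]
    tauto
  have hui := Set.ncard_union_add_ncard_inter (I ∩ {x | a ≤ x}) (I ∩ {x | b ≤ x})
    (hfin.inter_of_left _) (hfin.inter_of_left _)
  rw [hi, ha, hb] at hui
  have hsum : ∑ i, (a ⊓ b) i + ∑ i, (a ⊔ b) i = ∑ i, a i + ∑ i, b i := by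
    rw [← Finset.sum_add_distrib, ← Finset.sum_add_distrib]
    exact Finset.sum_congr rfl fun i _ => min_add_max (a i) (b i)
  have hzs : ∑ i, z i + 1 = n := hz
  have hsz : ∑ i, (a ⊔ b) i ≤ ∑ i, z i := Finset.sum_le_sum fun i _ => sup_le haz hbz i
  have hsa : ∑ i, a i ≤ ∑ i, z i := Finset.sum_le_sum fun i _ => haz i
  have hsb : ∑ i, b i ≤ ∑ i, z i := Finset.sum_le_sum fun i _ => hbz i
  omega

theorem SimplexIndep.augment {n d : ℕ} {I J : Set (Fin d → ℕ)} (hI : SimplexIndep n d I)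
    (hJ : SimplexIndep n d J) (hIJ : I.ncard < J.ncard) :
    ∃ e ∈ J, e ∉ I ∧ SimplexIndep n d (insert e I) := by
  classical
  by_contra! hcon
  have hI' := simplexIndep_iff.1 hI
  have hJ' := simplexIndep_iff.1 hJ
  have hIf : I.Finite := (latticeSimplex_finite n d).subset hI'.1
  have hJf : J.Finite := (latticeSimplex_finite n d).subset hJ'.1
  let Sat : (Fin d → ℕ) → Prop := fun a => (I ∩ {x | a ≤ x}).ncard = n - ∑ i, a i
  have hsat : ∀ e ∈ J \ I, ∃ a, a ≤ e ∧ Sat a := by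
    rintro e ⟨heJ, heI⟩
    by_contra! hno
    refine hcon e heJ heI (simplexIndep_iff.2 ⟨Set.insert_subset (hJ'.1 heJ) hI'.1, fun a => ?_⟩)
    by_cases hae : a ≤ e
    · have h1 := hI'.2 a
      have h2 : (I ∩ {x | a ≤ x}).ncard ≠ n - ∑ i, a i := hno a hae
      have h3 : insert e I ∩ {x | a ≤ x} ⊆ insert e (I ∩ {x | a ≤ x}) := by
        rintro x ⟨rfl | hx, hax⟩
        · exact Set.mem_insert _ _
        · exact Set.mem_insert_of_mem _ ⟨hx, hax⟩
      have h4 := Set.ncard_le_ncard h3 ((hIf.inter_of_left _).insert _)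
      have h5 := Set.ncard_insert_le e (I ∩ {x | a ≤ x})
      omega
    · have h3 : insert e I ∩ {x | a ≤ x} ⊆ I ∩ {x | a ≤ x} := by
        rintro x ⟨rfl | hx, hax⟩
        · exact absurd hax hae
        · exact ⟨hx, hax⟩
      exact (Set.ncard_le_ncard h3 (hIf.inter_of_left _)).trans (hI'.2 a)
  have hmin : ∀ e ∈ J \ I, ∃ a, a ≤ e ∧ Sat a ∧ ∀ b, b ≤ e → Sat b → a ≤ b := by
    rintro e he
    obtain ⟨a, ⟨hae, hsa⟩, hm⟩ := (measure fun a : Fin d → ℕ => ∑ i, a i).wf.has_min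
      {a | a ≤ e ∧ Sat a} (hsat e he)
    refine ⟨a, hae, hsa, fun b hbe hsb => ?_⟩
    have hs : Sat (a ⊓ b) := saturated_inf hI (hJ'.1 he.1) hae hbe hsa hsb
    have hlt : ¬ ∑ i, (a ⊓ b) i < ∑ i, a i := hm (a ⊓ b) ⟨inf_le_left.trans hae, hs⟩
    intro i
    by_contra hlt'
    refine hlt (Finset.sum_lt_sum (fun j _ => min_le_left _ _) ⟨i, Finset.mem_univ i, ?_⟩)
    exact lt_of_le_of_lt (min_le_right _ _) (not_le.1 hlt')
  choose! f hfe hfs hfm using hmin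
  -- two of the chosen maximal saturated simplices with a common point coincide
  have hdisj : ∀ e ∈ J \ I, ∀ e' ∈ J \ I, ∀ z ∈ latticeSimplex n d,
      f e ≤ z → f e' ≤ z → f e = f e' := by
    intro e he e' he' z hz h h'
    have hs : Sat (f e ⊓ f e') := saturated_inf hI hz h h' (hfs e he) (hfs e' he')
    have h1 : f e ≤ f e ⊓ f e' := hfm e he _ (inf_le_left.trans (hfe e he)) hs
    have h2 : f e' ≤ f e ⊓ f e' := hfm e' he' _ (inf_le_right.trans (hfe e' he')) hs
    exact le_antisymm (h1.trans inf_le_right) (h2.trans inf_le_left)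
  let A : Finset (Fin d → ℕ) := (hJf.sdiff (t := I)).toFinset.image f
  have hA : ∀ a ∈ A, ∃ e ∈ J \ I, f e = a := by
    intro a ha
    simpa [A, and_assoc] using ha
  let U : Set (Fin d → ℕ) := {x | ∃ a ∈ A, a ≤ x}
  have hcount : ∀ K : Set (Fin d → ℕ), K ⊆ latticeSimplex n d →
      (K ∩ U).ncard = ∑ a ∈ A, (K ∩ {x | a ≤ x}).ncard := by
    intro K hK
    have hKf : K.Finite := (latticeSimplex_finite n d).subset hK
    have hKe : ∀ s : Set (Fin d → ℕ), (K ∩ s).ncard = (hKf.toFinset.filter (· ∈ s)).card := by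
      intro s
      rw [← Set.ncard_coe_finset]
      congr 1
      ext x
      simp
    simp only [hKe]
    rw [← Finset.card_biUnion]
    · congr 1
      ext x
      simp only [Finset.mem_filter, Finset.mem_biUnion, U, Set.mem_ofPred_eq]
      tauto
    · intro a ha b hb hab
      rw [Function.onFun, Finset.disjoint_left]
      intro x hxa hxb
      simp only [Finset.mem_filter, Set.Finite.mem_toFinset, Set.mem_ofPred_eq] at hxa hxb
      obtain ⟨e, he, rfl⟩ := hA a ha
      obtain ⟨e', he', rfl⟩ := hA b hb
      exact hab (hdisj e he e' he' x (hK hxa.1) hxa.2 hxb.2)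
  have hUle : (J ∩ U).ncard ≤ (I ∩ U).ncard := by
    rw [hcount J hJ'.1, hcount I hI'.1]
    refine Finset.sum_le_sum fun a ha => ?_
    obtain ⟨e, he, rfl⟩ := hA a ha
    exact (hJ'.2 _).trans (hfs e he).ge
  have hdiff : J \ U ⊆ I \ U := by
    rintro x ⟨hx, hxU⟩
    refine ⟨?_, hxU⟩
    by_contra hxI
    exact hxU ⟨f x, Finset.mem_image_of_mem f (by simpa using ⟨hx, hxI⟩), hfe x ⟨hx, hxI⟩⟩
  have h1 := Set.ncard_le_ncard hdiff hIf.sdiff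
  have h2 := Set.ncard_inter_add_ncard_sdiff_eq_ncard J U hJf
  have h3 := Set.ncard_inter_add_ncard_sdiff_eq_ncard I U hIf
  omega

/-- The matroid `𝒯_{n,d}` on the ground set `T_{n,d}`: a set `I` of lattice points is independent
if and only if every parallel translate of `T_{k,d}` contains at most `k` points of `I`, for
every `k ≤ n`. -/
def simplexMatroid (n d : ℕ) : Matroid (Fin d → ℕ) :=
  (IndepMatroid.ofFinite (latticeSimplex_finite n d) (SimplexIndep n d)
    ⟨Set.empty_subset _, fun k _ a => by simp⟩
    (fun _ _ hJ hIJ => ⟨hIJ.trans hJ.1, fun k hk a => le_trans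
      (Set.ncard_le_ncard (Set.inter_subset_inter_left _ hIJ)
        (((latticeSimplex_finite n d).subset hJ.1).inter_of_left _)) (hJ.2 k hk a)⟩)
    (fun _ _ hI hJ hIJ => hI.augment hJ hIJ)
    (fun _ hI => hI.1)).matroid

/-- `f` is an isomorphism from the matroid `M` to the matroid `N`: a bijection between the ground
sets under which the independent sets correspond. -/
def IsMatroidIso {α β : Type*} (M : Matroid α) (N : Matroid β) (f : α → β) : Prop :=
  Set.BijOn f M.E N.E ∧ ∀ I ⊆ M.E, M.Indep I ↔ N.Indep (f '' I)

/-! Two conditions on the flags carry the theorem: members whose codimensions add up to `n` meet in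
zero, and for every independent set `I` of `𝒯_{n,d}` the lines indexed by `I` are independent.

The first condition forces every intersection of codimensions `a` to have dimension `n - ∑ a_k`
(`finrank_codimIntersection`), so the lines are indexed bijectively by the lattice points. It also
bounds independence from above: the lines indexed by points `x ≥ a` all lie in one space of
dimension `n - ∑ a_k` (`simplexIndep_of_sSupIndep`).

Both conditions say that homogeneous linear systems, with coefficients polynomial in the matrix
entries, have only the zero solution. Such a condition is generic once it holds at one point
(`IsGeneric.of_linear_system`), and only finitely many conditions occur. It therefore suffices to
find one special tuple of flags for each `I`.

That tuple is built in `exists_special_matrices`. The points of `I` label distinct coordinates of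
`ℂ^n`, and certain entries of the flag equations are set to zero, so that the coordinate axis
labelled `y` satisfies all equations of the line of `y`. The remaining entries are generic. The
counting condition defining `𝒯_{n,d}` becomes Hall's condition (`exists_matching`), and the matching
makes the equations independent enough for the line to be no larger than its axis. Distinct axes are
independent. -/

open scoped Matrix

/-! ### Generic points of an affine space -/

/-- A property of the points of an affine space is generic if it holds wherever some nonzero
polynomial does not vanish. -/
def IsGeneric {σ : Type*} (p : (σ → ℂ) → Prop) : Prop :=
  ∃ P : MvPolynomial σ ℂ, P ≠ 0 ∧ ∀ x, MvPolynomial.eval x P ≠ 0 → p x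

namespace IsGeneric

variable {σ : Type*} {p q : (σ → ℂ) → Prop}

theorem mono (hp : IsGeneric p) (h : ∀ x, p x → q x) : IsGeneric q := by
  obtain ⟨P, hP, hPp⟩ := hp
  exact ⟨P, hP, fun x hx => h x (hPp x hx)⟩

theorem and (hp : IsGeneric p) (hq : IsGeneric q) : IsGeneric fun x => p x ∧ q x := by
  obtain ⟨P, hP, hPp⟩ := hp
  obtain ⟨Q, hQ, hQq⟩ := hq
  refine ⟨P * Q, mul_ne_zero hP hQ, fun x hx => ?_⟩
  rw [map_mul] at hx
  exact ⟨hPp x (left_ne_zero_of_mul hx), hQq x (right_ne_zero_of_mul hx)⟩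

theorem all {ι : Type*} [Finite ι] {p : ι → (σ → ℂ) → Prop} (hp : ∀ i, IsGeneric (p i)) :
    IsGeneric fun x => ∀ i, p i x := by
  cases nonempty_fintype ι
  choose P hP hPp using hp
  refine ⟨∏ i, P i, Finset.prod_ne_zero_iff.2 fun i _ => hP i, fun x hx i => ?_⟩
  rw [map_prod, Finset.prod_ne_zero_iff] at hx
  exact hPp i x (hx i (Finset.mem_univ i))

theorem exists_point (hp : IsGeneric p) : ∃ x, p x := by
  obtain ⟨P, hP, hPp⟩ := hp
  by_contra! h
  exact hP (MvPolynomial.funext fun x => by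
    by_contra hx
    exact h x (hPp x (by simpa using hx)))

/-- If a homogeneous linear system with polynomial coefficients has only the zero solution at
one point, then it has only the zero solution at a generic point. -/
theorem of_linear_system {r c : Type*} [Finite r] [Fintype c]
    (M : r → c → MvPolynomial σ ℂ) (x₀ : σ → ℂ)
    (h₀ : ∀ w : c → ℂ, (∀ i, ∑ j, MvPolynomial.eval x₀ (M i j) * w j = 0) → w = 0) :
    IsGeneric fun x => ∀ w : c → ℂ, (∀ i, ∑ j, MvPolynomial.eval x (M i j) * w j = 0) → w = 0 := by
  classical
  cases nonempty_fintype r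
  let A : (σ → ℂ) → Matrix r c ℂ := fun x => (Matrix.of M).map (MvPolynomial.eval x)
  have hker : LinearMap.ker (A x₀).mulVecLin = ⊥ :=
    LinearMap.ker_eq_bot'.2 fun w hw => h₀ w fun i => congrFun hw i
  -- A constant left inverse `N` of the matrix at `x₀` replaces the choice of a maximal minor: `det
  -- (N * A x)` is polynomial in `x`, equals 1 at `x₀`, and `A x` is injective wherever it does not
  -- vanish.
  obtain ⟨φ, hφ⟩ := LinearMap.exists_leftInverse_of_injective _ hker
  let N : Matrix c r ℂ := LinearMap.toMatrix' φ
  have hN : N * A x₀ = 1 := by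
    have h := congrArg LinearMap.toMatrix' hφ
    rw [LinearMap.toMatrix'_comp, LinearMap.toMatrix'_id] at h
    rwa [← Matrix.toLin'_apply', LinearMap.toMatrix'_toLin'] at h
  let P : MvPolynomial σ ℂ := (N.map MvPolynomial.C * Matrix.of M).det
  have hP : ∀ x, MvPolynomial.eval x P = (N * A x).det := by
    intro x
    refine (RingHom.map_det _ _).trans (congrArg Matrix.det ?_)
    ext i j
    show MvPolynomial.eval x (∑ l, MvPolynomial.C (N i l) * M l j) =
      ∑ l, N i l * MvPolynomial.eval x (M l j)
    simp
  refine ⟨P, fun h => ?_, fun x hx w hw => ?_⟩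
  · have := hP x₀
    simp [h, hN] at this
  · rw [hP] at hx
    refine Matrix.mulVec_injective_of_det_ne_zero hx ?_
    have : A x *ᵥ w = 0 := funext hw
    show (N * A x) *ᵥ w = (N * A x) *ᵥ 0
    rw [← Matrix.mulVec_mulVec, this, Matrix.mulVec_zero, Matrix.mulVec_zero]

end IsGeneric

/-! ### Matchings -/

theorem card_filter_rev_lt {n m : ℕ} (hm : m ≤ n) :
    (Finset.univ.filter fun i : Fin n => (i.rev : ℕ) < m).card = m := by
  rw [← Finset.card_map Fin.revPerm.toEmbedding]
  have : (Finset.univ.filter fun i : Fin n => (i.rev : ℕ) < m).map Fin.revPerm.toEmbedding =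
      Finset.univ.filter fun i : Fin n => (i : ℕ) < m := by
    ext i
    simp only [Finset.mem_map, Finset.mem_filter, Finset.mem_univ, true_and]
    refine ⟨?_, fun h => ⟨i.rev, by simpa using h, by simp⟩⟩
    rintro ⟨j, hj, rfl⟩
    exact hj
  rw [this, Fin.card_filter_val_lt, min_eq_right hm]

theorem card_filter_rev_lt_prod {n d : ℕ} {a : Fin d → ℕ} (ha : ∀ k, a k ≤ n) :
    (Finset.univ.filter fun p : Fin d × Fin n => (p.2.rev : ℕ) < a p.1).card = ∑ k, a k := by
  rw [Finset.card_filter, ← Finset.univ_product_univ, Finset.sum_product]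
  refine Finset.sum_congr rfl fun k _ => ?_
  rw [← Finset.card_filter]
  exact card_filter_rev_lt (ha k)

theorem le_of_sum_le {n d : ℕ} {a : Fin d → ℕ} (ha : ∑ k, a k ≤ n) (k : Fin d) : a k ≤ n :=
  (Finset.single_le_sum (f := a) (fun _ _ => Nat.zero_le _) (Finset.mem_univ k)).trans ha

/-- An instance of Hall's theorem: the equations cutting out `E_a` can be matched with coordinates
on which they are allowed to be nonzero. -/
theorem exists_matching {n d : ℕ} {b : Fin n → Fin d → ℕ}
    (hb : ∀ a : Fin d → ℕ, {c | a ≤ b c}.ncard ≤ n - ∑ k, a k)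
    {a : Fin d → ℕ} (ha : ∑ k, a k ≤ n) :
    ∃ f : {p : Fin d × Fin n // (p.2.rev : ℕ) < a p.1} → Fin n, Function.Injective f ∧
      ∀ p, b (f p) p.1.1 ≤ p.1.2.rev := by
  classical
  have h := (Finset.all_card_le_biUnion_card_iff_exists_injective
    (fun p : {p : Fin d × Fin n // (p.2.rev : ℕ) < a p.1} =>
      Finset.univ.filter fun c => b c p.1.1 ≤ p.1.2.rev)).1 ?_
  · simpa using h
  intro s
  -- Enlarging `s` to the final segments of rows it spans in each flag does not enlarge its set of
  -- neighbours. The value is 0 for a flag without rows in `s`.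
  let m : Fin d → ℕ := fun k => (s.filter fun p => p.1.1 = k).sup fun p => (p.1.2.rev : ℕ) + 1
  have hm : ∀ p ∈ s, (p.1.2.rev : ℕ) < m p.1.1 := fun p hp =>
    Finset.le_sup (f := fun p : {p : Fin d × Fin n // (p.2.rev : ℕ) < a p.1} =>
      (p.1.2.rev : ℕ) + 1) (Finset.mem_filter.2 ⟨hp, rfl⟩)
  have hma : ∀ k, m k ≤ a k := fun k => Finset.sup_le fun p hp => by
    rw [← (Finset.mem_filter.1 hp).2]
    exact p.2
  have hmn : ∑ k, m k ≤ n := (Finset.sum_le_sum fun k _ => hma k).trans ha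
  have h1 : s.card ≤ ∑ k, m k := by
    rw [← card_filter_rev_lt_prod (le_of_sum_le hmn),
      ← Finset.card_map (Function.Embedding.subtype _)]
    refine Finset.card_le_card fun q hq => ?_
    obtain ⟨p, hp, rfl⟩ := Finset.mem_map.1 hq
    simpa using hm p hp
  -- A column with no neighbour in `s` must satisfy `m ≤ b c`, and `hb m` allows at most `n - ∑ m_k`
  -- of these; so at least `∑ m_k ≥ |s|` columns are neighbours.
  have h2 : (Finset.univ.filter fun c => ¬ m ≤ b c) ⊆
      s.biUnion fun p => Finset.univ.filter fun c => b c p.1.1 ≤ p.1.2.rev := by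
    intro c hc
    have hc' : ¬ m ≤ b c := (Finset.mem_filter.1 hc).2
    rw [Pi.le_def] at hc'
    push Not at hc'
    obtain ⟨k, hk⟩ := hc'
    obtain ⟨p, hp, hlt⟩ := (Finset.lt_sup_iff).1 hk
    rw [Finset.mem_filter] at hp
    refine Finset.mem_biUnion.2 ⟨p, hp.1, Finset.mem_filter.2 ⟨Finset.mem_univ _, ?_⟩⟩
    rw [hp.2]
    exact Nat.lt_succ_iff.1 hlt
  have h3 := Finset.card_le_card h2
  have h4 := Finset.card_filter_add_card_filter_not (s := (Finset.univ : Finset (Fin n)))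
    (fun c => m ≤ b c)
  rw [Finset.card_univ, Fintype.card_fin] at h4
  have h5 := hb m
  rw [Set.ncard_eq_toFinset_card', Set.toFinset_ofPred] at h5
  omega

/-! ### A special tuple of flags -/

/-- The matrices whose `(i, c)` entry is forced to vanish when `b c k > n - 1 - i`. -/
noncomputable def maskedMatrix {n d : ℕ} (b : Fin n → Fin d → ℕ) (x : Fin d × Fin n × Fin n → ℂ)
    (k : Fin d) : Matrix (Fin n) (Fin n) ℂ :=
  Matrix.of fun i c => if b c k ≤ i.rev then x (k, i, c) else 0

/-- The special point is the 0-1 incidence of `f`: there the row `p` reads `w (f p) = 0`, and the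
coordinates missed by `f` vanish by assumption. The condition `hfb` says that the mask leaves these
entries free. -/
theorem isGeneric_maskedMatrix {n d : ℕ} (b : Fin n → Fin d → ℕ) {a : Fin d → ℕ}
    (f : {p : Fin d × Fin n // (p.2.rev : ℕ) < a p.1} → Fin n)
    (hfb : ∀ p, b (f p) p.1.1 ≤ p.1.2.rev) :
    IsGeneric fun x : Fin d × Fin n × Fin n → ℂ => ∀ w : Fin n → ℂ,
      (∀ k i, (i.rev : ℕ) < a k → (maskedMatrix b x k *ᵥ w) i = 0) →
      (∀ c, c ∉ Set.range f → w c = 0) → w = 0 := by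
  classical
  let M : (Fin d × Fin n) ⊕ Fin n → Fin n → MvPolynomial (Fin d × Fin n × Fin n) ℂ :=
    Sum.elim (fun p c => if (p.2.rev : ℕ) < a p.1 ∧ b c p.1 ≤ p.2.rev
      then MvPolynomial.X (p.1, p.2, c) else 0)
      (fun c' c => if c' = c ∧ c' ∉ Set.range f then 1 else 0)
  let x₀ : Fin d × Fin n × Fin n → ℂ := fun q =>
    if ∃ h : (q.2.1.rev : ℕ) < a q.1, f ⟨(q.1, q.2.1), h⟩ = q.2.2 then 1 else 0
  refine (IsGeneric.of_linear_system M x₀ ?_).mono ?_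
  · intro w hw
    funext c
    by_cases hc : c ∈ Set.range f
    · obtain ⟨p, rfl⟩ := hc
      have h := hw (Sum.inl p.1)
      rw [Finset.sum_eq_single (f p)] at h
      · have hp := p.2
        simpa [-Fin.val_rev, M, x₀, hp, hfb p] using h
      · intro c _ hc
        have hp := p.2
        have : f ⟨(p.1.1, p.1.2), hp⟩ ≠ c := fun h => hc h.symm
        by_cases hbc : b c p.1.1 ≤ p.1.2.rev
        · simp [-Fin.val_rev, M, x₀, hp, hbc, this]
        · simp [-Fin.val_rev, M, hbc]
      · simp
    · have h := hw (Sum.inr c)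
      rw [Finset.sum_eq_single c] at h
      · simpa [-Fin.val_rev, -Set.mem_range, M, hc] using h
      · intro c' _ hc'
        simp [-Fin.val_rev, M, Ne.symm hc']
      · simp
  · intro x hx w hw hw0
    refine hx w ?_
    rintro (⟨k, i⟩ | c')
    · by_cases hi : (i.rev : ℕ) < a k
      · rw [← hw k i hi]
        refine Finset.sum_congr rfl fun c _ => ?_
        by_cases hbc : b c k ≤ i.rev <;> simp [-Fin.val_rev, M, maskedMatrix, hi, hbc]
      · exact Finset.sum_eq_zero fun c _ => by simp [-Fin.val_rev, M, hi]
    · refine Finset.sum_eq_zero fun c _ => ?_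
      by_cases hc : c' = c ∧ c' ∉ Set.range f
      · simp [-Fin.val_rev, M, hw0 c (hc.1 ▸ hc.2)]
      · simp [-Fin.val_rev, -Set.mem_range, M, hc]

/-- Invertible matrices, some entries of which are prescribed to vanish, such that the equations
given by their last rows are otherwise as independent as possible. -/
theorem exists_special_matrices {n d : ℕ} {b : Fin n → Fin d → ℕ}
    (hb : ∀ a : Fin d → ℕ, {c | a ≤ b c}.ncard ≤ n - ∑ k, a k) :
    ∃ h : Fin d → Matrix (Fin n) (Fin n) ℂ, (∀ k, IsUnit (h k)) ∧
      (∀ a : Fin d → ℕ, ∑ k, a k = n → ∀ w : Fin n → ℂ,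
        (∀ k i, (i.rev : ℕ) < a k → (h k *ᵥ w) i = 0) → w = 0) ∧
      ∀ c₀, ∑ k, b c₀ k + 1 = n → ∀ w : Fin n → ℂ,
        (∀ k i, (i.rev : ℕ) < b c₀ k → (h k *ᵥ w) i = 0) → ∀ c, c ≠ c₀ → w c = 0 := by
  classical
  have hm : ∀ a : {a : Fin d → Fin (n + 1) // ∑ k, (a k : ℕ) ≤ n},
      ∃ f : {p : Fin d × Fin n // (p.2.rev : ℕ) < a.1 p.1} → Fin n, Function.Injective f ∧
        ∀ p, b (f p) p.1.1 ≤ p.1.2.rev := fun a =>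
    exists_matching hb (a := fun k => (a.1 k : ℕ)) a.2
  choose f hf hfb using hm
  obtain ⟨x, hx⟩ := (IsGeneric.all fun a : {a : Fin d → Fin (n + 1) // ∑ k, (a k : ℕ) ≤ n} =>
    isGeneric_maskedMatrix b (a := fun k => (a.1 k : ℕ)) (f a) (hfb a)).exists_point
  have key : ∀ a : Fin d → ℕ, ∑ k, a k ≤ n →
      ∃ f : {p : Fin d × Fin n // (p.2.rev : ℕ) < a p.1} → Fin n, Function.Injective f ∧
        (∀ p, b (f p) p.1.1 ≤ p.1.2.rev) ∧ ∀ w : Fin n → ℂ,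
      (∀ k i, (i.rev : ℕ) < a k → (maskedMatrix b x k *ᵥ w) i = 0) →
      (∀ c, c ∉ Set.range f → w c = 0) → w = 0 := by
    intro a ha
    let a' : {a : Fin d → Fin (n + 1) // ∑ k, (a k : ℕ) ≤ n} :=
      ⟨fun k => ⟨a k, Nat.lt_succ_of_le (le_of_sum_le ha k)⟩, ha⟩
    exact ⟨f a', hf a', hfb a', hx a'⟩
  have hcard : ∀ a : Fin d → ℕ, ∑ k, a k ≤ n →
      Fintype.card {p : Fin d × Fin n // (p.2.rev : ℕ) < a p.1} = ∑ k, a k := fun a ha => by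
    rw [Fintype.card_subtype, card_filter_rev_lt_prod (le_of_sum_le ha)]
  have hzero : ∀ a : Fin d → ℕ, ∑ k, a k = n → ∀ w : Fin n → ℂ,
      (∀ k i, (i.rev : ℕ) < a k → (maskedMatrix b x k *ᵥ w) i = 0) → w = 0 := by
    intro a ha w hw
    obtain ⟨f, hf, -, h⟩ := key a ha.le
    -- With `n` equations the matching exhausts all coordinates, so no coordinate has to be assumed
    -- zero.
    have hs : Function.Surjective f :=
      ((Fintype.bijective_iff_injective_and_card f).2 ⟨hf, by
      rw [hcard a ha.le, ha, Fintype.card_fin]⟩).2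
    exact h w hw fun c hc => absurd (hs c) hc
  refine ⟨maskedMatrix b x, fun k => ?_, hzero, fun c₀ hc₀ w hw => ?_⟩
  · rw [← Matrix.mulVec_injective_iff_isUnit]
    refine (injective_iff_map_eq_zero (maskedMatrix b x k).mulVecLin).2 fun w hw => ?_
    -- Invertibility of one matrix is the case where all `n` equations come from the same flag.
    refine hzero (Pi.single k n) (by simp) w fun k' i hi => ?_
    obtain rfl : k' = k := by
      by_contra hk
      simp [hk] at hi
    exact congrFun hw i
  · obtain ⟨f, hf, hfb, h⟩ := key (b c₀) (by omega)
    -- The rows used here are exactly those masked in column `c₀`; hence the `n - 1` matched columns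
    -- are all the others.
    have hne : ∀ p, f p ≠ c₀ := fun p hp => by
      have h1 := hfb p
      have h2 := p.2
      rw [hp] at h1
      omega
    have hrange : Finset.univ.image f = Finset.univ.erase c₀ := by
      refine Finset.eq_of_subset_of_card_le (fun c hc => ?_) ?_
      · obtain ⟨p, -, rfl⟩ := Finset.mem_image.1 hc
        exact Finset.mem_erase.2 ⟨hne p, Finset.mem_univ _⟩
      · rw [Finset.card_image_of_injective _ hf, Finset.card_univ, hcard _ (by omega),
          Finset.card_erase_of_mem (Finset.mem_univ _), Finset.card_univ, Fintype.card_fin]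
        omega
    have hmem : ∀ c, c ≠ c₀ → c ∈ Set.range f := fun c hc => by
      have : c ∈ Finset.univ.image f := by simp [hrange, hc]
      simpa using this
    -- The axis `c₀` solves the masked equations, so its component can be subtracted from `w`,
    -- leaving a solution supported on the range of `f`.
    have hw' : w - Pi.single c₀ (w c₀) = 0 := by
      refine h _ (fun k i hi => ?_) fun c hc => ?_
      · have h0 : maskedMatrix b x k i c₀ = 0 := by
          simp [-Fin.val_rev, maskedMatrix, not_le.2 hi]
        rw [Matrix.mulVec_sub, Pi.sub_apply, hw k i hi, Matrix.mulVec_single]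
        simp [h0]
      · by_cases hc₀ : c = c₀
        · simp [hc₀]
        · exact absurd (hmem c hc₀) hc
    intro c hc
    have := congrFun hw' c
    simpa [hc] using this

/-! ### The flag variety as a quotient of the general linear group -/

namespace CompleteFlag

variable {n d : ℕ}

theorem ext_space {E F : CompleteFlag n} (h : ∀ i, E.space i = F.space i) : E = F := by
  cases E
  cases F
  congr
  exact funext h

theorem ofGL_mul_space (h g : Matrix.GeneralLinearGroup (Fin n) ℂ) (i : Fin (n + 1)) :
    (ofGL (h * g)).space i =
      ((ofGL g).space i).map (h : Matrix (Fin n) (Fin n) ℂ).mulVecLin := by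
  show Submodule.span ℂ _ = (Submodule.span ℂ _).map _
  rw [Submodule.map_span, Set.image_image]
  rfl

/-- Two representatives of a flag differ by an element of `B`, and right multiplication by it fixes
every flag. Left equivariance proves this without triangular matrices. -/
theorem ofGL_mul_congr {g g' : Matrix.GeneralLinearGroup (Fin n) ℂ} (hg : ofGL g' = ofGL g)
    (h : Matrix.GeneralLinearGroup (Fin n) ℂ) : ofGL (h * (g⁻¹ * g')) = ofGL h := by
  refine ext_space fun i => ?_
  rw [← mul_assoc, ofGL_mul_space, hg, ← ofGL_mul_space, mul_assoc, inv_mul_cancel, mul_one]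

/-- The members of the flag of `g` are cut out by the last rows of the adjugate of `g`. -/
theorem mem_ofGL_space_iff (g : Matrix.GeneralLinearGroup (Fin n) ℂ) (x : ℕ) (w : Fin n → ℂ) :
    w ∈ (ofGL g).space ⟨n - x, Nat.lt_succ_of_le (Nat.sub_le n x)⟩ ↔
      ∀ i : Fin n, (i.rev : ℕ) < x →
        ((g : Matrix (Fin n) (Fin n) ℂ).adjugate *ᵥ w) i = 0 := by
  set A : Matrix (Fin n) (Fin n) ℂ := ↑g
  have hlt : ∀ i : Fin n, (i : ℕ) < n - x ↔ ¬ (i.rev : ℕ) < x := fun i => by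
    rw [Fin.val_rev]
    omega
  have hdet : A.det ≠ 0 := ((Matrix.isUnit_iff_isUnit_det A).1 g.isUnit).ne_zero
  constructor
  · intro hw
    refine Submodule.span_induction (p := fun w _ => ∀ i : Fin n, (i.rev : ℕ) < x →
      (A.adjugate *ᵥ w) i = 0) ?_ ?_ ?_ ?_ hw
    · rintro _ ⟨j, hj, rfl⟩ i hi
      have hij : i ≠ j := fun h => (hlt j).1 hj (h ▸ hi)
      show (A.adjugate * A) i j = 0
      simp [Matrix.adjugate_mul, hij]
    · simp
    · intro u v _ _ hu hv i hi
      rw [Matrix.mulVec_add, Pi.add_apply, hu i hi, hv i hi, add_zero]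
    · intro c u _ hu i hi
      rw [Matrix.mulVec_smul, Pi.smul_apply, hu i hi, smul_zero]
  · intro hw
    have h1 : A *ᵥ (A.adjugate *ᵥ w) = A.det • w := by
      rw [Matrix.mulVec_mulVec, Matrix.mul_adjugate, Matrix.smul_mulVec, Matrix.one_mulVec]
    have h2 : w = A.det⁻¹ • ∑ j, (A.adjugate *ᵥ w) j • A.col j := by
      rw [eq_inv_smul_iff₀ hdet, ← h1]
      ext i
      simp [Matrix.mulVec, dotProduct, mul_comm]
    rw [h2]
    refine Submodule.smul_mem _ _ (Submodule.sum_mem _ fun j _ => ?_)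
    by_cases hj : (j.rev : ℕ) < x
    · rw [hw j hj, zero_smul]
      exact Submodule.zero_mem _
    · exact Submodule.smul_mem _ _ (Submodule.subset_span ⟨j, (hlt j).2 hj, rfl⟩)

end CompleteFlag

/-! ### Polynomial conditions on `GL_n(ℂ)^d` and open sets of flags -/

section

variable {n d : ℕ}

/-- The coordinates of a tuple of invertible matrices. -/
def glEntries (g : Fin d → Matrix.GeneralLinearGroup (Fin n) ℂ) : Fin d × Fin n × Fin n → ℂ :=
  fun p => (g p.1 : Matrix (Fin n) (Fin n) ℂ) p.2.1 p.2.2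

/-- The matrix with the given coordinates. -/
def entriesMatrix {R : Type*} (x : Fin d × Fin n × Fin n → R) (k : Fin d) :
    Matrix (Fin n) (Fin n) R :=
  Matrix.of fun i j => x (k, i, j)

theorem isGeneric_det_ne_zero (n d : ℕ) :
    IsGeneric fun x : Fin d × Fin n × Fin n → ℂ => ∀ k, (entriesMatrix x k).det ≠ 0 := by
  refine IsGeneric.all fun k => ?_
  have he : ∀ x : Fin d × Fin n × Fin n → ℂ,
      MvPolynomial.eval x (entriesMatrix MvPolynomial.X k).det = (entriesMatrix x k).det := by
    intro x
    refine (RingHom.map_det _ _).trans (congrArg Matrix.det ?_)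
    ext i j
    simp [entriesMatrix]
  refine ⟨(entriesMatrix MvPolynomial.X k).det, fun h => ?_, fun x hx => ne_of_eq_of_ne (he x).symm hx⟩
  have h1 := he fun p => if p.2.1 = p.2.2 then 1 else 0
  have h2 : entriesMatrix (fun p : Fin d × Fin n × Fin n => if p.2.1 = p.2.2 then (1 : ℂ) else 0) k
      = 1 := by
    ext i j
    simp [entriesMatrix, Matrix.one_apply]
  rw [h, map_zero, h2, Matrix.det_one] at h1
  exact zero_ne_one h1

/-- The flags represented by the points of a principal open subset of `GL_n(ℂ)^d` form a Zariski
open set. -/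
theorem isZariskiOpen_image (P : MvPolynomial (Fin d × Fin n × Fin n) ℂ) :
    IsZariskiOpen {E : Fin d → CompleteFlag n |
      ∃ g : Fin d → Matrix.GeneralLinearGroup (Fin n) ℂ,
        (fun k => CompleteFlag.ofGL (g k)) = E ∧ MvPolynomial.eval (glEntries g) P ≠ 0} := by
  -- `T b` is the right translate `g ↦ P(g b)`. The preimage of the image is the saturation of the
  -- locus `P ≠ 0` under `B^d`, that is, the union of the loci `T b ≠ 0` over those `b` that fix all
  -- flags.
  let T : (Fin d → Matrix.GeneralLinearGroup (Fin n) ℂ) → MvPolynomial (Fin d × Fin n × Fin n) ℂ :=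
    fun b => MvPolynomial.bind₁ (fun p => ∑ l, MvPolynomial.X (p.1, p.2.1, l) *
      MvPolynomial.C ((b p.1 : Matrix (Fin n) (Fin n) ℂ) l p.2.2)) P
  have hT : ∀ g b, MvPolynomial.eval (glEntries g) (T b) =
      MvPolynomial.eval (glEntries fun k => g k * b k) P := by
    intro g b
    refine (MvPolynomial.eval₂Hom_bind₁ _ _ _ _).trans ?_
    refine congrArg (fun x => MvPolynomial.eval x P) (funext fun p => ?_)
    show MvPolynomial.eval _ _ = _
    simp [glEntries, Matrix.mul_apply]
  refine ⟨{Q | ∃ b : Fin d → Matrix.GeneralLinearGroup (Fin n) ℂ,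
    (∀ k h, CompleteFlag.ofGL (h * b k) = CompleteFlag.ofGL h) ∧ T b = Q}, fun g => ?_⟩
  constructor
  · rintro ⟨g', hg', hP⟩
    refine ⟨_, ⟨fun k => (g k)⁻¹ * g' k,
      fun k h => CompleteFlag.ofGL_mul_congr (congrFun hg' k) h, rfl⟩, ?_⟩
    show MvPolynomial.eval (glEntries g) (T fun k => (g k)⁻¹ * g' k) ≠ 0
    have h := hT g fun k => (g k)⁻¹ * g' k
    rw [h]
    simpa only [mul_inv_cancel_left] using hP
  · rintro ⟨_, ⟨b, hb, rfl⟩, hQ⟩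
    refine ⟨_, funext fun k => hb k (g k), ?_⟩
    have h := hT g b
    rw [← h]
    exact hQ

/-- A good representative is enough, since `p` depends only on the flags. Nonemptiness needs a point
where all the determinants are nonzero as well. -/
theorem exists_isZariskiOpen_of_isGeneric {p : (Fin d → CompleteFlag n) → Prop}
    (hp : IsGeneric fun x => ∀ g : Fin d → Matrix.GeneralLinearGroup (Fin n) ℂ,
      glEntries g = x → p fun k => CompleteFlag.ofGL (g k)) :
    ∃ U : Set (Fin d → CompleteFlag n), IsZariskiOpen U ∧ U.Nonempty ∧ ∀ E ∈ U, p E := by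
  obtain ⟨P, hP, hPp⟩ := hp
  refine ⟨_, isZariskiOpen_image P, ?_, ?_⟩
  · have hP' : IsGeneric fun x => MvPolynomial.eval x P ≠ 0 := ⟨P, hP, fun _ hx => hx⟩
    obtain ⟨x, hx, hdet⟩ := (hP'.and (isGeneric_det_ne_zero n d)).exists_point
    exact ⟨_, fun k => Matrix.GeneralLinearGroup.mkOfDetNeZero _ (hdet k), rfl, hx⟩
  · rintro _ ⟨g, rfl, hg⟩
    exact hPp _ hg g rfl

theorem eval_adjugate (x : Fin d × Fin n × Fin n → ℂ) (k : Fin d) (i j : Fin n) :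
    MvPolynomial.eval x ((entriesMatrix MvPolynomial.X k).adjugate i j) =
      (entriesMatrix x k).adjugate i j := by
  have h := RingHom.map_adjugate (MvPolynomial.eval x)
    (entriesMatrix (n := n) (d := d) MvPolynomial.X k)
  have h2 : (MvPolynomial.eval x).mapMatrix (entriesMatrix (n := n) (d := d) MvPolynomial.X k) =
      entriesMatrix x k := by
    ext i j
    show MvPolynomial.eval x (MvPolynomial.X (k, i, j)) = _
    simp [entriesMatrix]
  rw [h2] at h
  exact congrFun (congrFun h i) j

theorem mem_codimIntersection_ofGL {g : Fin d → Matrix.GeneralLinearGroup (Fin n) ℂ}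
    {a : Fin d → ℕ} {w : Fin n → ℂ} :
    w ∈ codimIntersection (fun k => CompleteFlag.ofGL (g k)) a ↔
      ∀ k i, (i.rev : ℕ) < a k → ((entriesMatrix (glEntries g) k).adjugate *ᵥ w) i = 0 := by
  rw [codimIntersection, flagIntersection, Submodule.mem_iInf]
  exact forall_congr' fun k => CompleteFlag.mem_ofGL_space_iff (g k) (a k) w

/-! ### Generic transversality and independence -/

/-- The special tuple of flags, described by the columns of matrices. -/
theorem exists_special_point {b : Fin n → Fin d → ℕ}
    (hb : ∀ a : Fin d → ℕ, {c | a ≤ b c}.ncard ≤ n - ∑ k, a k) :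
    ∃ x : Fin d × Fin n × Fin n → ℂ,
      (∀ a : Fin d → ℕ, ∑ k, a k = n → ∀ w : Fin n → ℂ,
        (∀ k i, (Fin.rev i : ℕ) < a k → ((entriesMatrix x k).adjugate *ᵥ w) i = 0) → w = 0) ∧
      ∀ c₀, ∑ k, b c₀ k + 1 = n → ∀ w : Fin n → ℂ,
        (∀ k i, (Fin.rev i : ℕ) < b c₀ k → ((entriesMatrix x k).adjugate *ᵥ w) i = 0) →
          ∀ c, c ≠ c₀ → w c = 0 := by
  obtain ⟨h, hu, h1, h2⟩ := exists_special_matrices hb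
  -- The flags come from the inverses of the equation matrices; the adjugate of `(h k)⁻¹` is a
  -- nonzero multiple of `h k`.
  have hadj : ∀ k w i, ((h k)⁻¹.adjugate *ᵥ w) i = 0 → (h k *ᵥ w) i = 0 := by
    intro k w i hi
    have hd := (Matrix.isUnit_iff_isUnit_det _).1 (hu k)
    have : (h k)⁻¹.adjugate = (h k)⁻¹.det • h k := by
      calc (h k)⁻¹.adjugate = (h k)⁻¹.adjugate * ((h k)⁻¹ * h k) := by
            rw [Matrix.nonsing_inv_mul _ hd, mul_one]
        _ = _ := by rw [← mul_assoc, Matrix.adjugate_mul, smul_mul_assoc, one_mul]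
    rw [this, Matrix.smul_mulVec, Pi.smul_apply, smul_eq_zero] at hi
    exact hi.resolve_left ((Matrix.isUnit_nonsing_inv_det _ hd).ne_zero)
  refine ⟨fun p => (h p.1)⁻¹ p.2.1 p.2.2, fun a ha w hw => ?_, fun c₀ hc₀ w hw => ?_⟩
  · exact h1 a ha w fun k i hi => hadj k w i (hw k i hi)
  · exact h2 c₀ hc₀ w fun k i hi => hadj k w i (hw k i hi)

/-- Generic flags are transverse. -/
theorem isGeneric_codimIntersection_eq_bot {a : Fin d → ℕ} (ha : ∑ k, a k = n) :
    IsGeneric fun x => ∀ g : Fin d → Matrix.GeneralLinearGroup (Fin n) ℂ,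
      glEntries g = x → codimIntersection (fun k => CompleteFlag.ofGL (g k)) a = ⊥ := by
  -- With all labels zero nothing is masked, and the counting bound is trivial.
  obtain ⟨x₀, h₀, -⟩ := exists_special_point (n := n) (d := d) (b := fun _ => 0) fun a => by
    by_cases h : a = 0
    · simp [h]
    · simp [h]
  let M : Fin d × Fin n → Fin n → MvPolynomial (Fin d × Fin n × Fin n) ℂ := fun p c =>
    if (p.2.rev : ℕ) < a p.1 then (entriesMatrix MvPolynomial.X p.1).adjugate p.2 c else 0
  have hM : ∀ x w, (∀ p, ∑ c, MvPolynomial.eval x (M p c) * w c = 0) ↔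
      ∀ k i, (Fin.rev i : ℕ) < a k → ((entriesMatrix x k).adjugate *ᵥ w) i = 0 := by
    intro x w
    rw [Prod.forall]
    refine forall_congr' fun k => forall_congr' fun i => ?_
    by_cases hi : (i.rev : ℕ) < a k
    · simp only [M, hi, if_true, eval_adjugate, forall_const]
      rfl
    · simp [-Fin.val_rev, M, hi]
  refine (IsGeneric.of_linear_system M x₀ fun w hw => h₀ a ha w ((hM _ _).1 hw)).mono ?_
  rintro x hx g rfl
  rw [Submodule.eq_bot_iff]
  exact fun w hw => hx w ((hM _ _).2 (mem_codimIntersection_ofGL.1 hw))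

theorem SimplexIndep.exists_enumeration {I : Set (Fin d → ℕ)} (hI : SimplexIndep n d I) :
    ∃ (e : I ↪ Fin n) (b : Fin n → Fin d → ℕ), (∀ y, b (e y) = y) ∧
      ∀ a : Fin d → ℕ, {c | a ≤ b c}.ncard ≤ n - ∑ k, a k := by
  have hI' := (simplexIndep_iff.1 hI).2
  have hfin : I.Finite := (latticeSimplex_finite n d).subset hI.1
  have := hfin.fintype
  obtain ⟨e⟩ : Nonempty (I ↪ Fin n) := by
    refine Function.Embedding.nonempty_of_card_le ?_
    have h0 : I ∩ {x | 0 ≤ x} = I := Set.inter_eq_left.2 fun x _ i => Nat.zero_le _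
    have h := hI' 0
    rw [h0] at h
    rw [Fintype.card_fin, ← Nat.card_eq_fintype_card, Nat.card_coe_set_eq]
    exact h.trans (Nat.sub_le _ _)
  -- Spare columns get the label 0, which counts only towards the bound for `a = 0`, and that bound
  -- is `n`.
  refine ⟨e, Function.extend e Subtype.val 0, fun y => e.injective.extend_apply _ _ _, fun a => ?_⟩
  by_cases h : a = 0
  · subst h
    simp
  · refine le_trans ?_ (hI' a)
    have hex : ∀ c, a ≤ Function.extend e Subtype.val 0 c → ∃ y, e y = c := by
      intro c hc
      by_contra hno
      rw [Function.extend_apply' _ _ _ hno] at hc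
      exact h (le_antisymm hc (fun _ => Nat.zero_le _))
    refine Set.ncard_le_ncard_of_injOn (Function.extend e Subtype.val 0) ?_ ?_
      (hfin.inter_of_left _)
    · intro c hc
      obtain ⟨y, rfl⟩ := hex c hc
      refine ⟨?_, hc⟩
      rw [e.injective.extend_apply]
      exact y.2
    · intro c hc c' hc' hcc
      obtain ⟨y, rfl⟩ := hex c hc
      obtain ⟨y', rfl⟩ := hex c' hc'
      rw [e.injective.extend_apply, e.injective.extend_apply] at hcc
      rw [Subtype.ext hcc]

/-- For generic flags, the lines indexed by an independent set of `𝒯_{n,d}` are independent. -/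
theorem SimplexIndep.isGeneric_iSupIndep {I : Set (Fin d → ℕ)} (hI : SimplexIndep n d I) :
    IsGeneric fun x => ∀ g : Fin d → Matrix.GeneralLinearGroup (Fin n) ℂ,
      glEntries g = x →
        iSupIndep fun y : I => codimIntersection (fun k => CompleteFlag.ofGL (g k)) y := by
  classical
  have := ((latticeSimplex_finite n d).subset hI.1).fintype
  obtain ⟨e, b, heb, hb⟩ := hI.exists_enumeration
  obtain ⟨x₀, -, h₀⟩ := exists_special_point hb
  -- Independence as a linear system: the unknowns are one vector for each `y ∈ I`, required to lie
  -- on the line of `y` and to have sum zero.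
  let M : (I × Fin d × Fin n) ⊕ Fin n → I × Fin n → MvPolynomial (Fin d × Fin n × Fin n) ℂ :=
    Sum.elim
      (fun p q => if (p.2.2.rev : ℕ) < p.1.1 p.2.1 ∧ p.1 = q.1 then
        (entriesMatrix MvPolynomial.X p.2.1).adjugate p.2.2 q.2 else 0)
      (fun c q => if c = q.2 then 1 else 0)
  have hM : ∀ x (w : I × Fin n → ℂ), (∀ r, ∑ q, MvPolynomial.eval x (M r q) * w q = 0) ↔
      (∀ (y : I) k i, (Fin.rev i : ℕ) < y.1 k →
        ((entriesMatrix x k).adjugate *ᵥ fun c => w (y, c)) i = 0) ∧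
      ∀ c, ∑ y, w (y, c) = 0 := by
    intro x w
    rw [Sum.forall, Prod.forall]
    refine and_congr (forall_congr' fun y => ?_) (forall_congr' fun c => ?_)
    · rw [Prod.forall]
      refine forall_congr' fun k => forall_congr' fun i => ?_
      by_cases hi : (i.rev : ℕ) < y.1 k
      · rw [Fintype.sum_prod_type, Finset.sum_eq_single y]
        · simp only [M, hi, Sum.elim_inl, true_and, if_true, eval_adjugate, forall_const]
          rfl
        · intro y' _ hy'
          simp [M, Ne.symm hy']
        · simp
      · simp [-Fin.val_rev, M, hi]
    · rw [Fintype.sum_prod_type]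
      refine Eq.congr_left (Finset.sum_congr rfl fun y _ => ?_)
      rw [Finset.sum_eq_single c]
      · simp [M]
      · intro c' _ hc'
        simp [M, Ne.symm hc']
      · simp
  refine (IsGeneric.of_linear_system M x₀ fun w hw => ?_).mono ?_
  · rw [hM] at hw
    have hz : ∀ (y : I) c, c ≠ e y → w (y, c) = 0 := by
      intro y c hc
      refine h₀ (e y) ?_ (fun c => w (y, c)) ?_ c hc
      · rw [heb]
        exact hI.1 y.2
      · rw [heb]
        exact hw.1 y
    funext ⟨y, c⟩
    -- At the special point the vector of `y` is supported on the axis `e y`, so coordinate `e y` of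
    -- the vanishing sum isolates it.
    by_cases hc : c = e y
    · have h := hw.2 c
      rwa [Finset.sum_eq_single y] at h
      · exact fun y' _ hy' => hz y' c fun h' => hy' (e.injective (h'.symm.trans hc))
      · simp
    · exact hz y c hc
  · rintro x hx g rfl
    rw [iSupIndep_iff_finsetSum_eq_zero_imp_eq_zero]
    intro s v hv hsum y hy
    have h := hx (fun q => if q.1 ∈ s then v q.1 q.2 else 0) ((hM _ _).2 ⟨?_, fun c => ?_⟩)
    · funext c
      have := congrFun h (y, c)
      simpa [hy] using this
    · intro y k i hi
      by_cases hys : y ∈ s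
      · simp only [hys, if_true]
        exact mem_codimIntersection_ofGL.1 (hv y hys) k i hi
      · simp only [hys, if_false]
        exact congrFun (Matrix.mulVec_zero _) i
    · have := congrFun hsum c
      simpa [Finset.sum_ite_mem] using this

end

/-! ### Dimensions of intersections of transverse flags -/

section

variable {n d : ℕ}

theorem finrank_space_sub (E : CompleteFlag n) (x : ℕ) :
    Module.finrank ℂ (E.space ⟨n - x, Nat.lt_succ_of_le (Nat.sub_le n x)⟩) = n - x :=
  E.finrank_space _

theorem mem_codimIntersection {E : Fin d → CompleteFlag n} {a : Fin d → ℕ} {w : Fin n → ℂ} :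
    w ∈ codimIntersection E a ↔
      ∀ k, w ∈ (E k).space ⟨n - a k, Nat.lt_succ_of_le (Nat.sub_le n (a k))⟩ := by
  rw [codimIntersection, flagIntersection, Submodule.mem_iInf]

theorem codimIntersection_antitone (E : Fin d → CompleteFlag n) :
    Antitone (codimIntersection E) := by
  intro a b hab
  exact iInf_mono fun k => (E k).mono (Nat.sub_le_sub_left (hab k) n)

theorem le_finrank_codimIntersection_add (E : Fin d → CompleteFlag n) (a : Fin d → ℕ) :
    n ≤ Module.finrank ℂ (codimIntersection E a) + ∑ k, a k := by
  classical
  let F : Fin d → Submodule ℂ (Fin n → ℂ) := fun k =>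
    (E k).space ⟨n - a k, Nat.lt_succ_of_le (Nat.sub_le n (a k))⟩
  have key : ∀ s : Finset (Fin d), n ≤ Module.finrank ℂ ↥(s.inf F) + ∑ k ∈ s, a k := by
    intro s
    induction s using Finset.induction_on with
    | empty =>
      rw [Finset.inf_empty, finrank_top, Module.finrank_fin_fun, Finset.sum_empty, add_zero]
    | insert k s hk ih =>
      rw [Finset.inf_insert, Finset.sum_insert hk]
      have h1 := Submodule.finrank_sup_add_finrank_inf_eq (F k) (s.inf F)
      have h2 := Submodule.finrank_le (F k ⊔ s.inf F)
      have h3 : Module.finrank ℂ (F k) = n - a k := finrank_space_sub _ _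
      rw [Module.finrank_fin_fun] at h2
      omega
  have h := key Finset.univ
  rwa [Finset.inf_univ_eq_iInf] at h

theorem exists_le_sum_eq (a : Fin d → ℕ) {m : ℕ} (hm : m ≤ ∑ k, a k) :
    ∃ b ≤ a, ∑ k, b k = m := by
  induction m with
  | zero => exact ⟨0, fun _ => Nat.zero_le _, by simp⟩
  | succ m ih =>
    obtain ⟨b, hba, hb⟩ := ih (by omega)
    obtain ⟨k, -, hk⟩ := Finset.exists_lt_of_sum_lt (hb.trans_lt (Nat.lt_of_succ_le hm))
    refine ⟨b + Pi.single k 1, fun i => ?_, by simp [Finset.sum_add_distrib, hb]⟩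
    by_cases hi : i = k
    · subst hi
      simpa using hk
    · simpa [hi] using hba i

/-- The lower bound is subadditivity of codimension. For the upper bound, with `m = n - ∑ a_k`,
replacing `a k₀` by `a k₀ + m` gives total codimension `n`, so the intersection meets the deeper
member `F` in zero. Both lie in the member of codimension `a k₀`, where `F` has codimension `m`. -/
theorem finrank_codimIntersection (hd : 1 ≤ d) {E : Fin d → CompleteFlag n}
    (hE : ∀ a : Fin d → ℕ, ∑ k, a k = n → codimIntersection E a = ⊥) (a : Fin d → ℕ) :
    Module.finrank ℂ (codimIntersection E a) = n - ∑ k, a k := by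
  rcases le_total n (∑ k, a k) with h | h
  · obtain ⟨b, hba, hb⟩ := exists_le_sum_eq a h
    have h0 : codimIntersection E a = ⊥ :=
      le_bot_iff.1 ((codimIntersection_antitone E hba).trans (hE b hb).le)
    rw [h0, finrank_bot, Nat.sub_eq_zero_of_le h]
  · refine le_antisymm ?_ (by have := le_finrank_codimIntersection_add E a; omega)
    obtain ⟨m, hm⟩ := Nat.exists_eq_add_of_le h
    let k₀ : Fin d := ⟨0, hd⟩
    let F : Submodule ℂ (Fin n → ℂ) :=
      (E k₀).space ⟨n - (a k₀ + m), Nat.lt_succ_of_le (Nat.sub_le n _)⟩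
    have hinf : codimIntersection E a ⊓ F = ⊥ := by
      rw [← le_bot_iff, ← hE (a + Pi.single k₀ m) (by simp [Finset.sum_add_distrib, hm])]
      rintro w ⟨hw, hwF⟩
      rw [SetLike.mem_coe, mem_codimIntersection] at hw
      refine mem_codimIntersection.2 fun k => ?_
      by_cases hk : k = k₀
      · subst hk
        simpa using hwF
      · simpa [hk] using hw k
    have hsup : codimIntersection E a ⊔ F ≤
        (E k₀).space ⟨n - a k₀, Nat.lt_succ_of_le (Nat.sub_le n _)⟩ :=
      sup_le (iInf_le _ k₀) ((E k₀).mono (Nat.sub_le_sub_left (Nat.le_add_right _ _) n))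
    have h1 := Submodule.finrank_sup_add_finrank_inf_eq (codimIntersection E a) F
    have h2 := Submodule.finrank_mono hsup
    have h3 : a k₀ ≤ ∑ k, a k :=
      Finset.single_le_sum (f := a) (fun _ _ => Nat.zero_le _) (Finset.mem_univ k₀)
    rw [hinf, finrank_bot, finrank_space_sub] at h1
    rw [finrank_space_sub] at h2
    omega

/-! ### The lines of transverse flags -/

theorem flagIntersection_eq_codimIntersection (E : Fin d → CompleteFlag n)
    (a : Fin d → Fin (n + 1)) :
    flagIntersection E a = codimIntersection E fun k => n - (a k : ℕ) := by
  unfold codimIntersection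
  congr 1
  funext k
  exact Fin.ext (Nat.sub_sub_self (Nat.lt_succ_iff.1 (a k).2)).symm

theorem mem_latticeSimplex {x : Fin d → ℕ} : x ∈ latticeSimplex n d ↔ ∑ k, x k + 1 = n :=
  Iff.rfl

theorem ncard_latticeSimplex (hn : 1 ≤ n) (hd : 1 ≤ d) :
    (latticeSimplex n d).ncard = (n + d - 2).choose (d - 1) := by
  have h : latticeSimplex n d = (fun f : Fin d →₀ ℕ => (f : Fin d → ℕ)) ''
      (Finset.univ.finsuppAntidiag (n - 1) : Finset (Fin d →₀ ℕ)) := by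
    ext x
    simp only [mem_latticeSimplex, Set.mem_image, SetLike.mem_coe, Finset.mem_finsuppAntidiag,
      Finset.subset_univ, and_true]
    constructor
    · intro hx
      refine ⟨Finsupp.equivFunOnFinite.symm x, ?_, rfl⟩
      show ∑ k, x k = n - 1
      omega
    · rintro ⟨f, hf, rfl⟩
      rw [hf, Nat.sub_add_cancel hn]
  rw [h, Set.ncard_image_of_injective _ DFunLike.coe_injective, Set.ncard_coe_finset,
    Finset.card_finsuppAntidiag_nat_eq_choose, Finset.card_univ, Fintype.card_fin]
  have h1 : d + (n - 1) - 1 = n + d - 2 := by omega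
  rw [h1]
  exact Nat.choose_symm_of_eq_add (by omega)

theorem bijOn_codimIntersection (hd : 1 ≤ d) {E : Fin d → CompleteFlag n}
    (hE : ∀ a : Fin d → ℕ, ∑ k, a k = n → codimIntersection E a = ⊥) :
    Set.BijOn (codimIntersection E) (latticeSimplex n d) (lineArrangement E) := by
  have hdim := finrank_codimIntersection hd hE
  refine ⟨fun x hx => ⟨?_, _, rfl⟩, fun x hx y hy hxy => ?_, ?_⟩
  · have := mem_latticeSimplex.1 hx
    rw [hdim]
    omega
  · have hx' := mem_latticeSimplex.1 hx
    have hy' := mem_latticeSimplex.1 hy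
    -- A common line lies in the intersection for `x ⊔ y`; by the dimension formula `x ⊔ y` cannot
    -- have a larger sum than `x` or `y`.
    have hle : codimIntersection E x ≤ codimIntersection E (x ⊔ y) := by
      intro w hw
      have hw' := hxy ▸ hw
      rw [mem_codimIntersection] at hw hw' ⊢
      intro k
      rcases le_total (x k) (y k) with h | h
      · simpa [h] using hw' k
      · simpa [h] using hw k
    have h1 := Submodule.finrank_mono hle
    rw [hdim, hdim] at h1
    have h2 : ∑ k, (x ⊔ y) k ≤ ∑ k, x k := by omega
    have h3 : ∀ u v : Fin d → ℕ, u ≤ v → ∑ k, v k ≤ ∑ k, u k → u = v := fun u v huv h =>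
      funext fun k => (Finset.sum_eq_sum_iff_of_le fun k _ => huv k).1
        (le_antisymm (Finset.sum_le_sum fun k _ => huv k) h) k (Finset.mem_univ k)
    exact (h3 x _ le_sup_left h2).trans (h3 y _ le_sup_right (by omega)).symm
  · rintro _ ⟨h1, a, rfl⟩
    rw [flagIntersection_eq_codimIntersection] at h1 ⊢
    rw [hdim] at h1
    exact ⟨_, mem_latticeSimplex.2 (by omega), rfl⟩

/-! ### Comparison of the two matroids -/

theorem simplexMatroid_indep_iff {I : Set (Fin d → ℕ)} :
    (simplexMatroid n d).Indep I ↔ SimplexIndep n d I :=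
  Iff.rfl

theorem flagLineMatroid_indep_iff {E : Fin d → CompleteFlag n}
    {J : Set (Submodule ℂ (Fin n → ℂ))} :
    (flagLineMatroid E).Indep J ↔ J ⊆ lineArrangement E ∧ sSupIndep J := by
  simp [flagLineMatroid, lineMatroid]

/-- A set of independent lines in a subspace has at most as many elements as the dimension. -/
theorem ncard_le_finrank_of_sSupIndep {V : Type*} [AddCommGroup V] [Module ℂ V]
    [FiniteDimensional ℂ V] {J : Set (Submodule ℂ V)} (hJ : sSupIndep J)
    (h1 : ∀ L ∈ J, Module.finrank ℂ L = 1) {W : Submodule ℂ V} (hW : ∀ L ∈ J, L ≤ W) :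
    J.ncard ≤ Module.finrank ℂ W := by
  choose v hv using exists_generator_of_finrank_eq_one (V := V)
  have hv' : ∀ L ∈ J, v L ≠ 0 ∧ Submodule.span ℂ {v L} = L := fun L hL => hv L (h1 L hL)
  have hli : LinearIndependent ℂ fun L : J => v L :=
    (sSupIndep_lines_iff hv' subset_rfl).1 hJ
  have := hli.finite
  have := Fintype.ofFinite J
  have h := finrank_span_eq_card hli
  rw [← Nat.card_coe_set_eq, Nat.card_eq_fintype_card, ← h]
  refine Submodule.finrank_mono (Submodule.span_le.2 ?_)
  rintro _ ⟨L, rfl⟩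
  refine hW L L.2 ?_
  have := Submodule.mem_span_singleton_self (R := ℂ) (v L)
  rwa [(hv' L L.2).2] at this

/-- This direction needs only transversality: the lines of the points `x ≥ a` lie in a space of
dimension `n - ∑ a_k`. -/
theorem simplexIndep_of_sSupIndep (hd : 1 ≤ d) {E : Fin d → CompleteFlag n}
    (hE : ∀ a : Fin d → ℕ, ∑ k, a k = n → codimIntersection E a = ⊥) {I : Set (Fin d → ℕ)}
    (hI : I ⊆ latticeSimplex n d) (h : sSupIndep (codimIntersection E '' I)) :
    SimplexIndep n d I := by
  have hbij := bijOn_codimIntersection hd hE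
  refine simplexIndep_iff.2 ⟨hI, fun a => ?_⟩
  rw [← finrank_codimIntersection hd hE a, ←
    (hbij.injOn.mono (Set.inter_subset_left.trans hI)).ncard_image]
  refine ncard_le_finrank_of_sSupIndep (h.mono (Set.image_mono Set.inter_subset_left)) ?_ ?_
  · rintro _ ⟨x, hx, rfl⟩
    exact (hbij.mapsTo (hI hx.1)).1
  · rintro _ ⟨x, hx, rfl⟩
    exact codimIntersection_antitone E hx.2

/-- The vectors `a` and the sets `I` in question are finite in number, so one nonzero polynomial
serves for all of them. -/
theorem exists_isZariskiOpen_transverse_independent (n d : ℕ) :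
    ∃ U : Set (Fin d → CompleteFlag n), IsZariskiOpen U ∧ U.Nonempty ∧ ∀ E ∈ U,
      (∀ a : Fin d → ℕ, ∑ k, a k = n → codimIntersection E a = ⊥) ∧
      ∀ I, SimplexIndep n d I → iSupIndep fun y : I => codimIntersection E y := by
  have hfin1 : Finite {a : Fin d → ℕ // ∑ k, a k = n} :=
    Set.Finite.to_subtype (s := {a : Fin d → ℕ | ∑ k, a k = n})
      ((latticeSimplex_finite (n + 1) d).subset fun a (ha : ∑ k, a k = n) =>
        mem_latticeSimplex.2 (by rw [ha]))
  have hfin2 : Finite {I : Set (Fin d → ℕ) // SimplexIndep n d I} :=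
    Set.Finite.to_subtype (s := {I | SimplexIndep n d I})
      ((latticeSimplex_finite n d).finite_subsets.subset fun I hI => hI.1)
  refine exists_isZariskiOpen_of_isGeneric (((IsGeneric.all
    fun a : {a : Fin d → ℕ // ∑ k, a k = n} => isGeneric_codimIntersection_eq_bot a.2).and
    (IsGeneric.all fun I : {I : Set (Fin d → ℕ) // SimplexIndep n d I} =>
      I.2.isGeneric_iSupIndep)).mono ?_)
  rintro x ⟨h1, h2⟩ g hg
  exact ⟨fun a ha => h1 ⟨a, ha⟩ g hg, fun I hI => h2 ⟨I, hI⟩ g hg⟩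

end

theorem theorem5p1 (n d : ℕ) (hn : 1 ≤ n) (hd : 1 ≤ d) :
    ∃ U : Set (Fin d → CompleteFlag n), IsZariskiOpen U ∧ U.Nonempty ∧
      ∀ E ∈ U,
        (∀ a : Fin d → Fin (n + 1), Module.finrank ℂ (flagIntersection E a) = 1 ↔
          ∑ k, (a k : ℕ) = (d - 1) * n + 1) ∧
        (lineArrangement E).ncard = (n + d - 2).choose (d - 1) ∧
        IsMatroidIso (simplexMatroid n d) (flagLineMatroid E) (codimIntersection E) := by
  obtain ⟨U, hU, hne, hgen⟩ := exists_isZariskiOpen_transverse_independent n d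
  refine ⟨U, hU, hne, fun E hEU => ?_⟩
  obtain ⟨hE, hind⟩ := hgen E hEU
  have hbij := bijOn_codimIntersection hd hE
  refine ⟨fun a => ?_, ?_, hbij, fun I hI => ?_⟩
  · rw [flagIntersection_eq_codimIntersection, finrank_codimIntersection hd hE]
    have h1 : ∑ k, (n - (a k : ℕ)) + ∑ k, (a k : ℕ) = d * n := by
      rw [← Finset.sum_add_distrib, Finset.sum_congr rfl fun k _ =>
        Nat.sub_add_cancel (Nat.lt_succ_iff.1 (a k).2)]
      simp
    have h2 : d * n = (d - 1) * n + n := by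
      rw [← Nat.succ_mul, Nat.succ_eq_add_one, Nat.sub_add_cancel hd]
    omega
  · rw [← hbij.image_eq, hbij.injOn.ncard_image, ncard_latticeSimplex hn hd]
  · have hI' : I ⊆ latticeSimplex n d := hI
    rw [simplexMatroid_indep_iff, flagLineMatroid_indep_iff]
    refine ⟨fun h => ⟨hbij.image_eq ▸ Set.image_mono hI', ?_⟩,
      fun h => simplexIndep_of_sSupIndep hd hE hI' h.2⟩
    rw [Set.image_eq_range]
    exact (hind I h).sSupIndep_range
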